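/- Identify $\mathbb{C}^3$ with the Euclidean space $\mathbb{R}^6$. A smooth oriented embedded real 3-dimensional submanifold of $\mathbb{C}^3$ is called special Lagrangian if $\mathrm{Re}(dz^1\wedge dz^2\wedge dz^3)$ restricts to its Riemannian volume form. For $\Sigma\subset S^5=\{z\in\mathbb{C}^3:|z|=1\}$ let $C(\Sigma)=\{tx : t\ge 0,\ x\in\Sigma\}$; a set of the form $C=C(\Sigma)$ is a special Lagrangian cone with link $\Sigma=C\cap S^5$ if $C\setminus\{0\}$ is (for a suitable orientation) a special Lagrangian submanifold. There exists a countably infinite family $(C_k)_{k\in\mathbb{N}}$ of special Lagrangian cones in $\mathbb{C}^3$ such that: (1) for every $k$, the link $C_k\cap S^5$ is a smoothly embedded 2-torus, i.e. the image of $S^1\times S^1$ under a smooth embedding; (2) for every $k$, the link $C_k\cap S^5$ is invariant under a circle subgroup of $\mathrm{SU}(3)$, i.e. under the image of an injective continuous homomorphism $S^1\to\mathrm{SU}(3)$ (which may depend on $k$); (3) the cones are pairwise non-isometric: for $j\ne k$ there is no Riemannian isometry (metric-preserving diffeomorphism) from $C_j\setminus\{0\}$ onto $C_k\setminus\{0\}$,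 both with the metric induced from $\mathbb{R}^6$. -/

import Mathlib

open scoped Manifold ContDiff

noncomputable section

/-- `ℂ³` with its standard Hermitian norm, regarded below also as the Euclidean space `ℝ⁶`. -/
abbrev C3 : Type := EuclideanSpace ℂ (Fin 3)

/-- `φ : U → M` is a smooth local parametrization of `M ⊆ ℂ³ = ℝ⁶` as an embedded
3-dimensional submanifold: an immersion that is a homeomorphism onto an open subset of `M`. -/
structure IsLocalParam (M : Set C3) (U : Set (EuclideanSpace ℝ (Fin 3)))
    (φ : EuclideanSpace ℝ (Fin 3) → C3) : Prop where
  isOpen_domain : IsOpen U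
  smooth : ContDiffOn ℝ ∞ φ U
  immersion : ∀ x ∈ U, Function.Injective (fderiv ℝ φ x)
  embedding : Topology.IsEmbedding (U.domRestrict φ)
  open_image : ∃ W : Set C3, IsOpen W ∧ φ '' U = M ∩ W

/-- The `i`-th coordinate vector field `∂φ/∂xᵢ` of a parametrization. -/
def coordVec (φ : EuclideanSpace ℝ (Fin 3) → C3) (x : EuclideanSpace ℝ (Fin 3)) (i : Fin 3) : C3 :=
  fderiv ℝ φ x (EuclideanSpace.single i 1)

/-- `Re (dz¹ ∧ dz² ∧ dz³)` evaluated on three vectors: the special Lagrangian calibration. -/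
def reOmega (v : Fin 3 → C3) : ℝ :=
  (Matrix.det (Matrix.of fun i j => v j i)).re

/-- The Euclidean 3-volume of the parallelepiped spanned by three vectors of `ℂ³ = ℝ⁶`, that is,
the norm of `v₀ ∧ v₁ ∧ v₂` for the real inner product `Re ⟨·,·⟩`. -/
def vol3 (v : Fin 3 → C3) : ℝ :=
  √(Matrix.det (Matrix.of fun i j => (inner ℂ (v i) (v j)).re))

/-- `M` is a (smooth, embedded, oriented) special Lagrangian submanifold of `ℂ³`: it is covered by
local parametrizations in which the calibration `Re (dz¹ ∧ dz² ∧ dz³)` restricts to the volume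
form of the induced metric. Such parametrizations automatically overlap with positive Jacobian,
as the same 3-form is positive in each, so they form an oriented atlas; `M` carries the orientation
they define, and its oriented tangent planes are calibrated. -/
def IsSpecialLagrangian (M : Set C3) : Prop :=
  ∀ p ∈ M, ∃ (U : Set (EuclideanSpace ℝ (Fin 3))) (φ : EuclideanSpace ℝ (Fin 3) → C3),
    IsLocalParam M U φ ∧ p ∈ φ '' U ∧ ∀ x ∈ U, reOmega (coordVec φ x) = vol3 (coordVec φ x)

/-- The cone `{t x : t ≥ 0, x ∈ S}`. -/
def coneOn (S : Set C3) : Set C3 := {y | ∃ t : ℝ, 0 ≤ t ∧ ∃ x ∈ S, y = t • x}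

/-- The link `C ∩ S⁵` of a cone `C`. -/
def link (C : Set C3) : Set C3 := C ∩ Metric.sphere 0 1

/-- `C` is the cone on its link and is special Lagrangian away from the vertex. -/
def IsSpecialLagrangianCone (C : Set C3) : Prop :=
  C = coneOn (link C) ∧ IsSpecialLagrangian (C \ {0})

/-- `S` is a smoothly embedded 2-torus: the image of `S¹ × S¹` under a smooth immersion that is a
homeomorphism onto its image. -/
def IsEmbeddedTorus (S : Set C3) : Prop :=
  ∃ F : Circle × Circle → C3,
    ContMDiff ((𝓡 1).prod (𝓡 1)) 𝓘(ℝ, C3) ∞ F ∧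
    (∀ x, Function.Injective (mfderiv ((𝓡 1).prod (𝓡 1)) 𝓘(ℝ, C3) F x)) ∧
    Topology.IsEmbedding F ∧ Set.range F = S

/-- `S` is invariant under a circle subgroup of `SU(3)`, namely the image of an injective
continuous homomorphism `S¹ → SU(3)`. -/
def IsCircleInvariant (S : Set C3) : Prop :=
  ∃ ρ : Circle →* Matrix.specialUnitaryGroup (Fin 3) ℂ,
    Continuous ρ ∧ Function.Injective ρ ∧
    ∀ w : Circle, (fun x : C3 => Matrix.toEuclideanLin (ρ w : Matrix (Fin 3) (Fin 3) ℂ) x) '' S = S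

/-- `f` maps the submanifold `M` into `N`, smoothly and preserving the induced Riemannian metrics
(both read off in local parametrizations of `M`). -/
def IsMetricPreserving (f : C3 → C3) (M N : Set C3) : Prop :=
  Set.MapsTo f M N ∧ ∀ U φ, IsLocalParam M U φ →
    ContDiffOn ℝ ∞ (f ∘ φ) U ∧ ∀ x ∈ U, ∀ v, ‖fderiv ℝ (f ∘ φ) x v‖ = ‖fderiv ℝ φ x v‖

/-- The submanifolds `M` and `N`, with the Riemannian metrics induced from `ℂ³ = ℝ⁶`, are
isometric: there is a diffeomorphism between them preserving the metrics. -/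
def AreIsometric (M N : Set C3) : Prop :=
  ∃ f g : C3 → C3, IsMetricPreserving f M N ∧ IsMetricPreserving g N M ∧ Set.InvOn g f M N

end

open Complex Filter Function Set Topology
open scoped ComplexConjugate

noncomputable section

/-!
For every integer `m > 0`, the circle with weights `(m + 1, m, -(2m + 1))` acts on `ℂ³` through
`SU(3)`. On its real slice `(x, y, i h)` the vanishing of the moment map reads
`(m + 1) x² + m y² = (2m + 1) h²`, and sweeping the half `h ≥ 0` of this quadratic cone by the
circle gives a special Lagrangian cone `C_m` whose points have coordinates `x + i y ∈ ℂ` and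
`U ∈ S¹`.

An isometry between two such cones preserves the distance to the vertex: rays have finite length, so
it extends continuously by `0 ↦ 0`, and it is `1`-Lipschitz along rays, as is its inverse. It
therefore maps link to link. On `C_m` the coordinate `U` of a point at distance `r` from the vertex
rotates at most at speed `1 / (m r)` along unit-speed curves. The link of a fixed cone, a compact
torus, has bounded diameter, so its image in the link of `C_m` contains no two points with antipodal
values of `U` once `m` is large. Thus each cone is isometric to only finitely many `C_m`, and an
infinite pairwise non-isometric subfamily can be chosen greedily.
-/

/-! ### Embedded threefolds and their isometries -/

/-- The underlying notion of embedded submanifold in `IsSpecialLagrangian`: a subset of `ℂ³` covered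
by smooth local parametrizations by three real parameters. -/
def IsEmbeddedThreefold (M : Set C3) : Prop :=
  ∀ p ∈ M, ∃ U φ, IsLocalParam M U φ ∧ p ∈ φ '' U

lemma IsSpecialLagrangian.isEmbeddedThreefold {M : Set C3} (hM : IsSpecialLagrangian M) :
    IsEmbeddedThreefold M := fun p hp =>
  let ⟨U, φ, hφ, hpU, _⟩ := hM p hp
  ⟨U, φ, hφ, hpU⟩

lemma AreIsometric.symm {M N : Set C3} : AreIsometric M N → AreIsometric N M
  | ⟨f, g, hf, hg, h⟩ => ⟨g, f, hg, hf, h.symm⟩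

lemma exists_differentiableAt_leftInverse {𝕜 E F : Type*} [NontriviallyNormedField 𝕜]
    [NormedAddCommGroup E] [NormedSpace 𝕜 E] [CompleteSpace E]
    [NormedAddCommGroup F] [NormedSpace 𝕜 F] {φ : E → F} {φ' : E →L[𝕜] F} {x : E}
    (hφ : HasStrictFDerivAt φ φ' x) (hφ' : φ'.HasLeftInverse) :
    ∃ ψ : F → E, DifferentiableAt 𝕜 ψ (φ x) ∧ ∀ᶠ y in 𝓝 x, ψ (φ y) = y := by
  obtain ⟨A, hA⟩ := hφ'
  have hAφ : HasStrictFDerivAt (A ∘ φ) ((ContinuousLinearEquiv.refl 𝕜 E : E ≃L[𝕜] E) : E →L[𝕜] E)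
      x := (A.hasStrictFDerivAt.comp x hφ).congr_fderiv (ContinuousLinearMap.ext hA)
  exact ⟨hAφ.localInverse _ _ _ ∘ A,
    hAφ.to_localInverse.differentiableAt.comp (φ x) A.differentiableAt,
    hAφ.eventually_left_inverse⟩

namespace IsLocalParam

variable {M U φ} {x : EuclideanSpace ℝ (Fin 3)}

lemma contDiffAt (hφ : IsLocalParam M U φ) (hx : x ∈ U) : ContDiffAt ℝ ∞ φ x :=
  hφ.smooth.contDiffAt (hφ.isOpen_domain.mem_nhds hx)

lemma map_nhds (hφ : IsLocalParam M U φ) (hx : x ∈ U) : map φ (𝓝 x) = 𝓝[M] (φ x) := by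
  obtain ⟨W, hW, hφW⟩ := hφ.open_image
  have hxW : φ x ∈ W := (hφW.subset (mem_image_of_mem φ hx)).2
  have h := hφ.embedding.map_nhds_eq ⟨x, hx⟩
  rw [show U.domRestrict φ = φ ∘ Subtype.val from rfl, ← map_map,
    map_nhds_subtype_coe_eq_nhds hx (hφ.isOpen_domain.mem_nhds hx), range_comp,
    Subtype.range_coe] at h
  rw [h, hφW, comp_apply, nhdsWithin_inter_of_mem' (mem_nhdsWithin_of_mem_nhds
    (hW.mem_nhds hxW))]

lemma exists_differentiableAt_inverse (hφ : IsLocalParam M U φ) (hx : x ∈ U) :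
    ∃ ψ, DifferentiableAt ℝ ψ (φ x) ∧ ψ (φ x) = x ∧ ∀ᶠ z in 𝓝[M] (φ x), φ (ψ z) = z := by
  have hφx := (hφ.contDiffAt hx).hasStrictFDerivAt (by simp)
  obtain ⟨ψ, hψ, hψφ⟩ := exists_differentiableAt_leftInverse hφx
    (.of_injective_of_finiteDimensional (hφ.immersion x hx))
  refine ⟨ψ, hψ, hψφ.self_of_nhds, ?_⟩
  rw [← hφ.map_nhds hx, eventually_map]
  exact hψφ.mono fun y hy => congrArg φ hy

end IsLocalParam

namespace IsMetricPreserving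

variable {f g : C3 → C3} {M N : Set C3}

lemma continuousOn (hf : IsMetricPreserving f M N) (hM : IsEmbeddedThreefold M) :
    ContinuousOn f M := by
  intro p hp
  obtain ⟨U, φ, hφ, x, hx, rfl⟩ := hM p hp
  rw [ContinuousWithinAt, ← hφ.map_nhds hx, tendsto_map'_iff]
  exact ((hf.2 U φ hφ).1.contDiffAt (hφ.isOpen_domain.mem_nhds hx)).continuousAt

lemma exists_hasDerivAt_comp (hf : IsMetricPreserving f M N) (hM : IsEmbeddedThreefold M)
    {γ : ℝ → C3} {v : C3} {t : ℝ} (hγM : ∀ᶠ s in 𝓝 t, γ s ∈ M) (hγ : HasDerivAt γ v t) :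
    ∃ v', HasDerivAt (f ∘ γ) v' t ∧ ‖v'‖ = ‖v‖ := by
  obtain ⟨U, φ, hφ, x, hx, hxt⟩ := hM (γ t) hγM.self_of_nhds
  obtain ⟨ψ, hψ, hψx, hφψ⟩ := hφ.exists_differentiableAt_inverse hx
  obtain ⟨hfφ, hnorm⟩ := hf.2 U φ hφ
  rw [hxt] at hψ hψx hφψ
  have hγM' : Tendsto γ (𝓝 t) (𝓝[M] (γ t)) := tendsto_nhdsWithin_iff.2 ⟨hγ.continuousAt, hγM⟩
  have hψγ : HasDerivAt (ψ ∘ γ) (fderiv ℝ ψ (γ t) v) t := hψ.hasFDerivAt.comp_hasDerivAt t hγ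
  have hcomp (F : C3 → C3) (hF : DifferentiableAt ℝ (F ∘ φ) x) :
      HasDerivAt (F ∘ γ) (fderiv ℝ (F ∘ φ) x (fderiv ℝ ψ (γ t) v)) t := by
    refine (hF.hasFDerivAt.comp_hasDerivAt_of_eq t hψγ hψx.symm).congr_of_eventuallyEq ?_
    exact (hγM'.eventually hφψ).mono fun s hs => (congrArg F hs).symm
  refine ⟨_, hcomp f ((hfφ.contDiffAt (hφ.isOpen_domain.mem_nhds hx)).differentiableAt (by simp)),
    ?_⟩
  have hγ' := hcomp id ((hφ.contDiffAt hx).differentiableAt (by simp))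
  rw [hnorm x hx]
  exact congrArg norm (hγ'.unique hγ)

/-! ### Isometries of cones preserve the distance to the vertex -/

lemma norm_map_smul_sub_le (hf : IsMetricPreserving f M N) (hM : IsEmbeddedThreefold M) {p : C3}
    (hp : ∀ r : ℝ, 0 < r → r • p ∈ M) {r s : ℝ} (hr : 0 < r) (hs : 0 < s) :
    ‖f (s • p) - f (r • p)‖ ≤ ‖p‖ * ‖s - r‖ := by
  have hray (t : ℝ) (ht : t ∈ Ioi 0) :
      ∃ v, HasDerivAt (fun t : ℝ => f (t • p)) v t ∧ ‖v‖ = ‖p‖ :=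
    hf.exists_hasDerivAt_comp hM (eventually_of_mem (Ioi_mem_nhds ht) hp)
      (by simpa using (hasDerivAt_id t).smul_const p)
  choose! v hv hvp using hray
  exact (convex_Ioi 0).norm_image_sub_le_of_norm_hasDerivWithin_le
    (fun t ht => (hv t ht).hasDerivWithinAt) (fun t ht => (hvp t ht).le) hr hs

-- The limit exists because the ray has finite length; were it a point of `N`, then `g` would
-- map it to `0`, which is not a point of `M`.
lemma tendsto_map_smul (hf : IsMetricPreserving f M N) (hg : IsMetricPreserving g N M)
    (hgf : LeftInvOn g f M) (hM : IsEmbeddedThreefold M) (hN : IsEmbeddedThreefold N)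
    (hM0 : 0 ∉ M) (hN0 : IsClosed (insert 0 N)) {p : C3} (hp : ∀ r : ℝ, 0 < r → r • p ∈ M) :
    Tendsto (fun r : ℝ => f (r • p)) (𝓝[>] 0) (𝓝 0) := by
  have hlip : LipschitzOnWith ‖p‖₊ (fun r : ℝ => f (r • p)) (Ioi 0) :=
    .of_dist_le_mul fun s hs r hr => by
      simpa only [dist_eq_norm, coe_nnnorm] using hf.norm_map_smul_sub_le hM hp hr hs
  obtain ⟨k, hk, hfk⟩ := hlip.extend_finite_dimension
  have hlim : Tendsto (fun r : ℝ => f (r • p)) (𝓝[>] 0) (𝓝 (k 0)) :=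
    (tendsto_nhdsWithin_of_tendsto_nhds (hk.continuous.tendsto 0)).congr'
      (hfk.symm.eventuallyEq_of_mem self_mem_nhdsWithin)
  have hmem : ∀ᶠ r : ℝ in 𝓝[>] 0, f (r • p) ∈ N :=
    eventually_mem_nhdsWithin.mono fun r hr => hf.1 (hp r hr)
  suffices k 0 = 0 by rwa [this] at hlim
  refine (hN0.mem_of_tendsto hlim (hmem.mono fun r => mem_insert_of_mem 0)).resolve_right
    fun hkN => ?_
  have hgk : Tendsto (fun r : ℝ => g (f (r • p))) (𝓝[>] 0) (𝓝 (g (k 0))) :=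
    (hg.continuousOn hN _ hkN).tendsto.comp (tendsto_nhdsWithin_iff.2 ⟨hlim, hmem⟩)
  have hg0 : Tendsto (fun r : ℝ => g (f (r • p))) (𝓝[>] 0) (𝓝 0) := by
    refine Tendsto.congr' (eventually_mem_nhdsWithin.mono fun r hr => (hgf (hp r hr)).symm) ?_
    exact tendsto_nhdsWithin_of_tendsto_nhds
      (Continuous.tendsto' (by fun_prop) 0 0 (zero_smul ℝ p))
  exact hM0 (tendsto_nhds_unique hgk hg0 ▸ hg.1 hkN)

lemma norm_map_le (hf : IsMetricPreserving f M N) (hg : IsMetricPreserving g N M)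
    (hgf : LeftInvOn g f M) (hM : IsEmbeddedThreefold M) (hN : IsEmbeddedThreefold N)
    (hM0 : 0 ∉ M) (hN0 : IsClosed (insert 0 N)) {p : C3} (hp : ∀ r : ℝ, 0 < r → r • p ∈ M) :
    ‖f p‖ ≤ ‖p‖ := by
  have hlim : Tendsto (fun r : ℝ => ‖f p - f (r • p)‖) (𝓝[>] 0) (𝓝 ‖f p - 0‖) :=
    ((hf.tendsto_map_smul hg hgf hM hN hM0 hN0 hp).const_sub (f p)).norm
  have hbound : Tendsto (fun r : ℝ => ‖p‖ * ‖1 - r‖) (𝓝[>] 0) (𝓝 ‖p‖) :=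
    tendsto_nhdsWithin_of_tendsto_nhds (Continuous.tendsto' (by fun_prop) 0 _ (by simp))
  rw [← sub_zero (f p)]
  refine le_of_tendsto_of_tendsto hlim hbound (eventually_mem_nhdsWithin.mono fun r hr => ?_)
  simpa only [one_smul] using hf.norm_map_smul_sub_le hM hp hr one_pos

end IsMetricPreserving

lemma isClosed_coneOn {S : Set C3} (hS : IsCompact S) (hS1 : S ⊆ Metric.sphere 0 1) :
    IsClosed (coneOn S) := by
  have : CompactSpace S := isCompact_iff_compactSpace.1 hS
  suffices coneOn S = Prod.fst '' {z : C3 × S | z.1 = ‖z.1‖ • (z.2 : C3)} by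
    rw [this]
    exact isClosedMap_fst_of_compactSpace _ (isClosed_eq (by fun_prop) (by fun_prop))
  apply Subset.antisymm
  · rintro _ ⟨t, ht, x, hx, rfl⟩
    have hx1 : ‖x‖ = 1 := mem_sphere_zero_iff_norm.1 (hS1 hx)
    exact ⟨(t • x, ⟨x, hx⟩), by simp [norm_smul, hx1, abs_of_nonneg ht], rfl⟩
  · rintro _ ⟨⟨y, x⟩, hy, rfl⟩
    exact ⟨‖y‖, norm_nonneg y, x, x.2, hy⟩

namespace IsSpecialLagrangianCone

variable {C C' : Set C3}

lemma smul_mem (hC : IsSpecialLagrangianCone C) {p : C3} (hp : p ∈ C) {r : ℝ} (hr : 0 ≤ r) :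
    r • p ∈ C := by
  rw [hC.1] at hp ⊢
  obtain ⟨t, ht, x, hx, rfl⟩ := hp
  exact ⟨r * t, by positivity, x, hx, smul_smul r t x⟩

lemma smul_mem_diff_zero (hC : IsSpecialLagrangianCone C) {p : C3} (hp : p ∈ C \ {0}) {r : ℝ}
    (hr : 0 < r) : r • p ∈ C \ {0} :=
  ⟨hC.smul_mem hp.1 hr.le, smul_ne_zero hr.ne' hp.2⟩

lemma isClosed_insert_zero (hC : IsSpecialLagrangianCone C) (hlink : IsCompact (link C)) :
    IsClosed (insert 0 (C \ {0})) := by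
  rw [insert_sdiff_singleton, insert_eq, hC.1]
  exact isClosed_singleton.union (isClosed_coneOn hlink inter_subset_right)

lemma norm_map_eq (hC : IsSpecialLagrangianCone C) (hC' : IsSpecialLagrangianCone C')
    (hlink : IsCompact (link C)) (hlink' : IsCompact (link C')) {f g : C3 → C3}
    (hf : IsMetricPreserving f (C \ {0}) (C' \ {0}))
    (hg : IsMetricPreserving g (C' \ {0}) (C \ {0})) (hinv : InvOn g f (C \ {0}) (C' \ {0}))
    {p : C3} (hp : p ∈ C \ {0}) : ‖f p‖ = ‖p‖ := by
  have hM := hC.2.isEmbeddedThreefold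
  have hN := hC'.2.isEmbeddedThreefold
  refine le_antisymm (hf.norm_map_le hg hinv.1 hM hN (fun h => h.2 rfl)
    (hC'.isClosed_insert_zero hlink') fun r hr => hC.smul_mem_diff_zero hp hr) ?_
  calc ‖p‖ = ‖g (f p)‖ := by rw [hinv.1 hp]
    _ ≤ ‖f p‖ := hg.norm_map_le hf hinv.2 hN hM (fun h => h.2 rfl)
      (hC.isClosed_insert_zero hlink) fun r hr => hC'.smul_mem_diff_zero (hf.1 hp) hr

end IsSpecialLagrangianCone

/-! ### Curves in embedded tori -/

namespace IsEmbeddedTorus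

variable {S : Set C3}

lemma isCompact (hS : IsEmbeddedTorus S) : IsCompact S := by
  obtain ⟨F, hF, -, -, rfl⟩ := hS
  exact isCompact_range hF.continuous

lemma exists_contDiff_surjOn (hS : IsEmbeddedTorus S) :
    ∃ Λ : ℝ × ℝ → C3, ContDiff ℝ ∞ Λ ∧ (∀ a, Λ a ∈ S) ∧
      SurjOn Λ (Metric.closedBall 0 Real.pi) S := by
  obtain ⟨F, hF, -, -, rfl⟩ := hS
  refine ⟨fun a => F (Circle.exp a.1, Circle.exp a.2), ?_, fun a => mem_range_self _, ?_⟩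
  · rw [← contMDiff_iff_contDiff]
    exact hF.comp ((contMDiff_circleExp.comp contDiff_fst.contMDiff).prodMk
      (contMDiff_circleExp.comp contDiff_snd.contMDiff))
  · rintro _ ⟨⟨u, v⟩, rfl⟩
    refine ⟨(arg u, arg v), ?_, by simp only [Circle.exp_arg]⟩
    rw [mem_closedBall_zero_iff, Prod.norm_def, max_le_iff]
    exact ⟨abs_arg_le_pi u, abs_arg_le_pi v⟩

lemma exists_forall_exists_curve (hS : IsEmbeddedTorus S) :
    ∃ L : ℝ, ∀ p ∈ S, ∀ q ∈ S, ∃ γ γ' : ℝ → C3, γ 0 = p ∧ γ 1 = q ∧ (∀ t, γ t ∈ S) ∧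
      (∀ t, HasDerivAt γ (γ' t) t) ∧ ∀ t ∈ Icc (0 : ℝ) 1, ‖γ' t‖ ≤ L := by
  obtain ⟨Λ, hΛ, hΛS, hsurj⟩ := hS.exists_contDiff_surjOn
  obtain ⟨K, hK⟩ := (isCompact_closedBall (0 : ℝ × ℝ) Real.pi).exists_bound_of_continuousOn
    (hΛ.continuous_fderiv (by simp)).continuousOn
  refine ⟨K * (2 * Real.pi), fun p hp q hq => ?_⟩
  obtain ⟨a, ha, rfl⟩ := hsurj hp
  obtain ⟨b, hb, rfl⟩ := hsurj hq
  have hline (t : ℝ) (ht : t ∈ Icc (0 : ℝ) 1) :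
      AffineMap.lineMap a b t ∈ Metric.closedBall (0 : ℝ × ℝ) Real.pi :=
    (convex_closedBall 0 Real.pi).lineMap_mem ha hb ht
  have hab : ‖b - a‖ ≤ 2 * Real.pi := by
    rw [mem_closedBall_zero_iff] at ha hb
    linarith [norm_sub_le b a]
  refine ⟨Λ ∘ AffineMap.lineMap a b, fun t => fderiv ℝ Λ (AffineMap.lineMap a b t) (b - a),
    by simp, by simp, fun t => hΛS _, fun t => ?_, fun t ht => ?_⟩
  · exact ((hΛ.differentiable (by simp)) _).hasFDerivAt.comp_hasDerivAt t
      AffineMap.hasDerivAt_lineMap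
  · exact ((fderiv ℝ Λ _).le_opNorm _).trans (mul_le_mul (hK _ (hline t ht)) hab (norm_nonneg _)
      ((norm_nonneg _).trans (hK _ (hline t ht))))

end IsEmbeddedTorus

/-! ### The circle action -/

/-- The element with parameter `ζ` of the circle subgroup of `SU(3)` with weights
`(m + 1, m, -(2m + 1))`; the complex conjugate stands for the inverse, so that the entries are
polynomials in `ζ` and `conj ζ`. -/
def weightMatrix (m : ℕ) (ζ : ℂ) : Matrix (Fin 3) (Fin 3) ℂ :=
  Matrix.diagonal ![ζ ^ (m + 1), ζ ^ m, conj ζ ^ (2 * m + 1)]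

lemma weightMatrix_mul (m : ℕ) (ζ η : ℂ) :
    weightMatrix m (ζ * η) = weightMatrix m ζ * weightMatrix m η := by
  rw [weightMatrix, weightMatrix, weightMatrix, Matrix.diagonal_mul_diagonal]
  congr 1
  ext i
  fin_cases i <;> simp [mul_pow]

lemma weightMatrix_one (m : ℕ) : weightMatrix m 1 = 1 := by
  rw [weightMatrix, ← Matrix.diagonal_one]
  congr 1
  ext i
  fin_cases i <;> simp

lemma conjTranspose_weightMatrix (m : ℕ) (ζ : ℂ) :
    (weightMatrix m ζ).conjTranspose = weightMatrix m (conj ζ) := by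
  rw [weightMatrix, weightMatrix, Matrix.diagonal_conjTranspose]
  congr 1
  ext i
  fin_cases i <;> simp

lemma conj_mul_self_circle (ζ : Circle) : conj (ζ : ℂ) * ζ = 1 := by
  rw [← Circle.coe_inv_eq_conj, ← Circle.coe_mul, inv_mul_cancel, Circle.coe_one]

lemma det_weightMatrix (m : ℕ) (ζ : Circle) : (weightMatrix m ζ).det = 1 := by
  rw [weightMatrix, Matrix.det_diagonal, Fin.prod_univ_three]
  calc _ = (conj (ζ : ℂ) * ζ) ^ (2 * m + 1) := by simp only [Matrix.cons_val]; ring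
    _ = 1 := by rw [conj_mul_self_circle, one_pow]

lemma conjTranspose_mul_weightMatrix (m : ℕ) (ζ : Circle) :
    (weightMatrix m ζ).conjTranspose * weightMatrix m ζ = 1 := by
  rw [conjTranspose_weightMatrix, ← weightMatrix_mul, conj_mul_self_circle, weightMatrix_one]

lemma conjTranspose_mul_weightMatrix_mul (m : ℕ) (ζ : Circle) (A : Matrix (Fin 3) (Fin 3) ℂ) :
    (weightMatrix m ζ * A).conjTranspose * (weightMatrix m ζ * A) = A.conjTranspose * A := by
  rw [Matrix.conjTranspose_mul, Matrix.mul_assoc,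
    ← Matrix.mul_assoc (weightMatrix m ζ).conjTranspose,
    conjTranspose_mul_weightMatrix, Matrix.one_mul]

/-- The circle subgroup of `SU(3)` with weights `(m + 1, m, -(2m + 1))`, which leaves the link of
`torusCone m` invariant. -/
def weightHom (m : ℕ) : Circle →* Matrix.specialUnitaryGroup (Fin 3) ℂ where
  toFun ζ := ⟨weightMatrix m ζ, Matrix.mem_specialUnitaryGroup_iff.2
    ⟨Matrix.mem_unitaryGroup_iff'.2 (conjTranspose_mul_weightMatrix m ζ), det_weightMatrix m ζ⟩⟩
  map_one' := Subtype.ext (weightMatrix_one m)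
  map_mul' ζ η := Subtype.ext (weightMatrix_mul m ζ η)

lemma continuous_weightHom (m : ℕ) : Continuous (weightHom m) := by
  refine (Continuous.matrix_diagonal (continuous_pi fun i => ?_)).subtype_mk _
  fin_cases i <;> simp only [Fin.zero_eta, Fin.mk_one, Fin.reduceFinMk, Matrix.cons_val] <;>
    fun_prop

lemma weightHom_injective (m : ℕ) : Injective (weightHom m) := by
  intro ζ η h
  have hentry (i : Fin 3) : weightMatrix m ζ i i = weightMatrix m η i i :=
    congrFun (congrFun (congrArg Subtype.val h) i) i
  have h0 := hentry 0
  have h1 := hentry 1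
  simp only [weightMatrix, Matrix.diagonal_apply_eq, Matrix.cons_val] at h0 h1
  rw [pow_succ, pow_succ, h1] at h0
  exact Circle.ext (mul_left_cancel₀ (pow_ne_zero m η.coe_ne_zero) h0)

/-! ### The cones -/

/-- The nonnegative solution `h` of `(m + 1) x² + m y² = (2m + 1) h²`, where `w = x + i y`: the
moment map equation of the circle action, which the cone over a real slice has to satisfy in order
to be Lagrangian. -/
def coneHeight (m : ℕ) (w : ℂ) : ℝ :=
  √(((m + 1) * w.re ^ 2 + m * w.im ^ 2) / (2 * m + 1))

/-- The parametrization of `torusCone m`: the point `(x, y, i h)` of the slice over `w = x + i y`,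
moved by the group element `U` of the circle with weights `(m + 1, m, -(2m + 1))`. The parameter `U`
ranges over `ℂ`, so that smoothness makes sense, but only unit complex numbers matter. -/
def coneMap (m : ℕ) (w U : ℂ) : C3 :=
  !₂[U ^ (m + 1) * w.re, U ^ m * w.im, conj U ^ (2 * m + 1) * (I * coneHeight m w)]

/-- The special Lagrangian cone swept out by the circle with weights `(m + 1, m, -(2m + 1))`. -/
def torusCone (m : ℕ) : Set C3 := {z | ∃ (w : ℂ) (U : Circle), z = coneMap m w U}

@[simp] lemma coneMap_apply_zero (m : ℕ) (w U : ℂ) : coneMap m w U 0 = U ^ (m + 1) * w.re := rfl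

@[simp] lemma coneMap_apply_one (m : ℕ) (w U : ℂ) : coneMap m w U 1 = U ^ m * w.im := rfl

@[simp] lemma coneMap_apply_two (m : ℕ) (w U : ℂ) :
    coneMap m w U 2 = conj U ^ (2 * m + 1) * (I * coneHeight m w) := rfl

lemma coneHeight_smul (m : ℕ) {r : ℝ} (hr : 0 ≤ r) (w : ℂ) :
    coneHeight m (r • w) = r * coneHeight m w := by
  rw [coneHeight, coneHeight, ← Real.sqrt_sq hr, ← Real.sqrt_mul (sq_nonneg _), Real.sqrt_sq hr]
  congr 1
  rw [smul_re, smul_im, smul_eq_mul, smul_eq_mul]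
  ring

lemma coneMap_smul (m : ℕ) {r : ℝ} (hr : 0 ≤ r) (w U : ℂ) :
    coneMap m (r • w) U = r • coneMap m w U := by
  ext i
  fin_cases i
  · simp; ring
  · simp; ring
  · simp only [Fin.reduceFinMk, coneMap_apply_two, coneHeight_smul m hr, ofReal_mul,
      PiLp.smul_apply]
    rw [real_smul]
    ring

lemma coneMap_zero (m : ℕ) (U : ℂ) : coneMap m 0 U = 0 := by
  simpa using coneMap_smul m le_rfl 0 U

lemma toEuclideanLin_weightMatrix_coneMap (m : ℕ) (ζ w U : ℂ) :
    Matrix.toEuclideanLin (weightMatrix m ζ) (coneMap m w U) = coneMap m w (ζ * U) := by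
  ext i
  fin_cases i <;> simp [weightMatrix, Matrix.toLpLin_apply, Matrix.mulVec_diagonal] <;> ring

lemma norm_sq_eq_re_sq_add_im_sq (w : ℂ) : ‖w‖ ^ 2 = w.re ^ 2 + w.im ^ 2 := by
  rw [Complex.sq_norm, normSq_apply, sq, sq]

lemma norm_sq_coneMap (m : ℕ) (w : ℂ) (U : Circle) :
    ‖coneMap m w U‖ ^ 2 = ‖w‖ ^ 2 + coneHeight m w ^ 2 := by
  rw [EuclideanSpace.norm_sq_eq, Fin.sum_univ_three, norm_sq_eq_re_sq_add_im_sq w]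
  simp [Circle.norm_coe]

lemma coneMap_ne_zero (m : ℕ) {w : ℂ} (hw : w ≠ 0) (U : Circle) : coneMap m w U ≠ 0 := by
  intro h
  have hsq := norm_sq_coneMap m w U
  rw [h, norm_zero] at hsq
  nlinarith [norm_pos_iff.2 hw, sq_nonneg (coneHeight m w)]

lemma mem_torusCone_diff_zero {m : ℕ} {z : C3} :
    z ∈ torusCone m \ {0} ↔ ∃ (w : ℂ) (U : Circle), w ≠ 0 ∧ z = coneMap m w U := by
  constructor
  · rintro ⟨⟨w, U, rfl⟩, h0⟩
    exact ⟨w, U, fun hw => h0 (hw ▸ coneMap_zero m U), rfl⟩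
  · rintro ⟨w, U, hw, rfl⟩
    exact ⟨⟨w, U, rfl⟩, coneMap_ne_zero m hw U⟩

lemma smul_mem_torusCone {m : ℕ} {z : C3} (hz : z ∈ torusCone m) {r : ℝ} (hr : 0 ≤ r) :
    r • z ∈ torusCone m := by
  obtain ⟨w, U, rfl⟩ := hz
  exact ⟨r • w, U, (coneMap_smul m hr w U).symm⟩

lemma toEuclideanLin_weightMatrix_mem_link {m : ℕ} (ζ : Circle) {z : C3}
    (hz : z ∈ link (torusCone m)) :
    Matrix.toEuclideanLin (weightMatrix m ζ) z ∈ link (torusCone m) := by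
  obtain ⟨⟨w, U, rfl⟩, h1⟩ := hz
  rw [toEuclideanLin_weightMatrix_coneMap]
  refine ⟨⟨w, ζ * U, rfl⟩, ?_⟩
  rw [mem_sphere_zero_iff_norm] at h1 ⊢
  rw [← sq_eq_sq₀ (norm_nonneg _) zero_le_one, ← Circle.coe_mul, norm_sq_coneMap,
    ← norm_sq_coneMap m w U, h1]

lemma isCircleInvariant_link_torusCone (m : ℕ) : IsCircleInvariant (link (torusCone m)) := by
  refine ⟨weightHom m, continuous_weightHom m, weightHom_injective m, fun ζ => ?_⟩
  change (fun z => Matrix.toEuclideanLin (weightMatrix m ζ) z) '' _ = _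
  apply Subset.antisymm
  · exact image_subset_iff.2 fun z hz => toEuclideanLin_weightMatrix_mem_link ζ hz
  · intro z hz
    refine ⟨_, toEuclideanLin_weightMatrix_mem_link ζ⁻¹ hz, ?_⟩
    obtain ⟨⟨w, U, rfl⟩, -⟩ := hz
    change Matrix.toEuclideanLin _ _ = _
    rw [toEuclideanLin_weightMatrix_coneMap, toEuclideanLin_weightMatrix_coneMap,
      ← Circle.coe_mul, ← Circle.coe_mul, mul_inv_cancel_left]

/-! ### Coordinates on the cones -/

/-- A polynomial whose value at `coneMap m w U` is a positive multiple of `U`, for every `m`. -/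
def orbitPhase (z : C3) : ℂ := z 0 ^ 2 * (-I * z 2) + conj (z 1 ^ 2 * (-I * z 2))

/-- The coordinate `U` of the point `coneMap m w U`, as a function on `ℂ³`. -/
def orbitAngle (z : C3) : ℂ := NormedSpace.normalize (orbitPhase z)

/-- The coordinate `w` of the point `coneMap m w U`, as a function on `ℂ³`. -/
def orbitBase (m : ℕ) (z : C3) : ℂ :=
  z 0 * conj (orbitAngle z) ^ (m + 1) + I * (z 1 * conj (orbitAngle z) ^ m)

lemma orbitPhase_coneMap (m : ℕ) (w : ℂ) (U : Circle) :
    orbitPhase (coneMap m w U) = (coneHeight m w * ‖w‖ ^ 2) • (U : ℂ) := by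
  have hUU := conj_mul_self_circle U
  have h1 : ((U : ℂ) ^ (m + 1)) ^ 2 * conj (U : ℂ) ^ (2 * m + 1) = U := by
    calc _ = (conj (U : ℂ) * U) ^ (2 * m + 1) * U := by ring
      _ = U := by rw [hUU, one_pow, one_mul]
  have h2 : (conj (U : ℂ) ^ m) ^ 2 * (U : ℂ) ^ (2 * m + 1) = U := by
    calc _ = (conj (U : ℂ) * U) ^ (2 * m) * U := by ring
      _ = U := by rw [hUU, one_pow, one_mul]
  rw [norm_sq_eq_re_sq_add_im_sq, orbitPhase]
  simp only [coneMap_apply_zero, coneMap_apply_one, coneMap_apply_two, map_mul, map_neg, map_pow,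
    conj_conj, conj_ofReal, conj_I, real_smul]
  push_cast
  linear_combination coneHeight m w * (w.re ^ 2 * h1 + w.im ^ 2 * h2)
    - coneHeight m w * (w.re ^ 2 * ((U : ℂ) ^ (m + 1)) ^ 2 * conj (U : ℂ) ^ (2 * m + 1)
      + w.im ^ 2 * (conj (U : ℂ) ^ m) ^ 2 * (U : ℂ) ^ (2 * m + 1)) * I_sq

section Pos

variable {m : ℕ} (hm : 0 < m) {w : ℂ} (hw : w ≠ 0) (U : Circle)

include hm hw

lemma coneHeight_radicand_pos : 0 < ((m + 1) * w.re ^ 2 + m * w.im ^ 2) / (2 * (m : ℝ) + 1) := by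
  have : (0 : ℝ) < m := by exact_mod_cast hm
  have hw' : 0 < w.re ^ 2 + w.im ^ 2 := by
    rw [← norm_sq_eq_re_sq_add_im_sq]
    exact pow_pos (norm_pos_iff.2 hw) 2
  have : 0 < m * (w.re ^ 2 + w.im ^ 2) + w.re ^ 2 := by positivity
  exact div_pos (by linarith) (by positivity)

lemma coneHeight_pos : 0 < coneHeight m w := Real.sqrt_pos.2 (coneHeight_radicand_pos hm hw)

lemma orbitPhase_factor_pos : 0 < coneHeight m w * ‖w‖ ^ 2 :=
  mul_pos (coneHeight_pos hm hw) (pow_pos (norm_pos_iff.2 hw) 2)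

lemma orbitPhase_coneMap_ne_zero : orbitPhase (coneMap m w U) ≠ 0 := by
  rw [orbitPhase_coneMap]
  exact smul_ne_zero (orbitPhase_factor_pos hm hw).ne' U.coe_ne_zero

lemma orbitAngle_coneMap : orbitAngle (coneMap m w U) = U := by
  rw [orbitAngle, orbitPhase_coneMap,
    NormedSpace.normalize_smul_of_pos (orbitPhase_factor_pos hm hw),
    NormedSpace.normalize_eq_self_of_norm_eq_one U.norm_coe]

lemma orbitBase_coneMap : orbitBase m (coneMap m w U) = w := by
  have hpow (n : ℕ) : (U : ℂ) ^ n * conj (U : ℂ) ^ n = 1 := by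
    rw [← mul_pow, mul_comm, conj_mul_self_circle, one_pow]
  rw [orbitBase, orbitAngle_coneMap hm hw, coneMap_apply_zero, coneMap_apply_one]
  conv_rhs => rw [← re_add_im w]
  linear_combination (w.re : ℂ) * hpow (m + 1) + (w.im : ℂ) * I * hpow m

end Pos

/-! ### Smoothness and velocities -/

lemma contDiff_conj : ContDiff ℝ ∞ fun z : ℂ => conj z := conjCLE.contDiff

lemma contDiff_ofReal : ContDiff ℝ ∞ fun x : ℝ => (x : ℂ) := ofRealCLM.contDiff

lemma contDiffAt_normalize {E : Type*} [NormedAddCommGroup E] [InnerProductSpace ℝ E] {x : E}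
    (hx : x ≠ 0) : ContDiffAt ℝ ∞ (fun x : E => NormedSpace.normalize x) x :=
  ((contDiffAt_norm ℝ hx).inv (norm_ne_zero_iff.2 hx)).smul contDiffAt_id

lemma contDiff_orbitPhase : ContDiff ℝ ∞ orbitPhase := by
  have h (i : Fin 3) : ContDiff ℝ ∞ fun z : C3 => z i := contDiff_piLp_apply 2
  have hterm (i : Fin 3) : ContDiff ℝ ∞ fun z : C3 => z i ^ 2 * (-I * z 2) :=
    ((h i).pow 2).mul (contDiff_const.mul (h 2))
  exact (hterm 0).add (contDiff_conj.comp (hterm 1))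

lemma contDiffAt_orbitAngle {z : C3} (hz : orbitPhase z ≠ 0) : ContDiffAt ℝ ∞ orbitAngle z :=
  (contDiffAt_normalize hz).comp z contDiff_orbitPhase.contDiffAt

lemma contDiffAt_orbitBase (m : ℕ) {z : C3} (hz : orbitPhase z ≠ 0) :
    ContDiffAt ℝ ∞ (orbitBase m) z := by
  have h (i : Fin 3) : ContDiffAt ℝ ∞ (fun z : C3 => z i) z := contDiffAt_piLp_apply 2
  have hc : ContDiffAt ℝ ∞ (fun z => conj (orbitAngle z)) z :=
    contDiff_conj.contDiffAt.comp z (contDiffAt_orbitAngle hz)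
  exact ((h 0).mul (hc.pow _)).add (contDiffAt_const.mul ((h 1).mul (hc.pow _)))

lemma contDiffAt_coneHeight {m : ℕ} (hm : 0 < m) {w : ℂ} (hw : w ≠ 0) :
    ContDiffAt ℝ ∞ (coneHeight m) w := by
  refine ContDiffAt.sqrt ?_ (coneHeight_radicand_pos hm hw).ne'
  have hre : ContDiff ℝ ∞ re := reCLM.contDiff
  have him : ContDiff ℝ ∞ im := imCLM.contDiff
  fun_prop

lemma contDiffAt_coneMap {m : ℕ} (hm : 0 < m) {w : ℂ} (hw : w ≠ 0) (U : ℂ) :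
    ContDiffAt ℝ ∞ (fun p : ℂ × ℂ => coneMap m p.1 p.2) (w, U) := by
  have hre : ContDiff ℝ ∞ fun p : ℂ × ℂ => (p.1.re : ℂ) :=
    contDiff_ofReal.comp (reCLM.contDiff.comp contDiff_fst)
  have him : ContDiff ℝ ∞ fun p : ℂ × ℂ => (p.1.im : ℂ) :=
    contDiff_ofReal.comp (imCLM.contDiff.comp contDiff_fst)
  have hh : ContDiffAt ℝ ∞ (fun p : ℂ × ℂ => (coneHeight m p.1 : ℂ)) (w, U) :=
    contDiff_ofReal.contDiffAt.comp _
      (ContDiffAt.comp (g := coneHeight m) (w, U) (contDiffAt_coneHeight hm hw) contDiffAt_fst)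
  have hc : ContDiff ℝ ∞ fun p : ℂ × ℂ => conj p.2 := contDiff_conj.comp contDiff_snd
  refine (contDiffAt_piLp 2).2 fun i => ?_
  fin_cases i
  · exact ((contDiff_snd.pow _).mul hre).contDiffAt
  · exact ((contDiff_snd.pow _).mul him).contDiffAt
  · exact (hc.contDiffAt.pow _).mul (contDiffAt_const.mul hh)

/-- The derivative of `coneHeight m` at `w` in the direction `w'`. -/
def coneHeightDeriv (m : ℕ) (w w' : ℂ) : ℝ :=
  ((m + 1) * w.re * w'.re + m * w.im * w'.im) / ((2 * m + 1) * coneHeight m w)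

/-- The velocity of `coneMap m w U` when `w` moves with velocity `w'` and `U` rotates with angular
velocity `θ`. -/
def coneVelocity (m : ℕ) (w U w' : ℂ) (θ : ℝ) : C3 :=
  !₂[U ^ (m + 1) * (w'.re + ((m + 1) * θ * w.re : ℝ) * I),
    U ^ m * (w'.im + (m * θ * w.im : ℝ) * I),
    conj U ^ (2 * m + 1) * I * (coneHeightDeriv m w w'
      + (-(2 * m + 1) * θ * coneHeight m w : ℝ) * I)]

lemma hasDerivAt_coneHeight {m : ℕ} (hm : 0 < m) {w : ℝ → ℂ} {w' : ℂ} {t : ℝ}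
    (hw : HasDerivAt w w' t) (hw0 : w t ≠ 0) :
    HasDerivAt (fun s => coneHeight m (w s)) (coneHeightDeriv m (w t) w') t := by
  have hre : HasDerivAt (fun s => (w s).re) w'.re t := reCLM.hasFDerivAt.comp_hasDerivAt t hw
  have him : HasDerivAt (fun s => (w s).im) w'.im t := imCLM.hasFDerivAt.comp_hasDerivAt t hw
  have h := ((((hre.pow 2).const_mul ((m : ℝ) + 1)).add
    ((him.pow 2).const_mul (m : ℝ))).div_const (2 * m + 1)).sqrt
    (coneHeight_radicand_pos hm hw0).ne'
  refine h.congr_deriv ?_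
  change _ / (2 * coneHeight m (w t)) = _
  have := (coneHeight_pos hm hw0).ne'
  rw [coneHeightDeriv]
  simp only [Nat.cast_ofNat, Nat.add_one_sub_one, pow_one]
  field_simp

lemma hasDerivAt_coneMap {m : ℕ} (hm : 0 < m) {w U : ℝ → ℂ} {w' : ℂ} {θ t : ℝ}
    (hw : HasDerivAt w w' t) (hw0 : w t ≠ 0) (hU : HasDerivAt U (U t * (θ * I)) t) :
    HasDerivAt (fun s => coneMap m (w s) (U s)) (coneVelocity m (w t) (U t) w' θ) t := by
  have hre : HasDerivAt (fun s => ((w s).re : ℂ)) w'.re t :=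
    (reCLM.hasFDerivAt.comp_hasDerivAt t hw).ofReal_comp
  have him : HasDerivAt (fun s => ((w s).im : ℂ)) w'.im t :=
    (imCLM.hasFDerivAt.comp_hasDerivAt t hw).ofReal_comp
  have hh := (hasDerivAt_coneHeight hm hw hw0).ofReal_comp
  have hUc : HasDerivAt (fun s => conj (U s)) (conj (U t * (θ * I))) t := hU.star
  suffices h : HasDerivAt (fun s => WithLp.ofLp (coneMap m (w s) (U s)))
      (WithLp.ofLp (coneVelocity m (w t) (U t) w' θ)) t from
    (PiLp.hasFDerivAt_toLp (𝕜 := ℝ) (E := fun _ : Fin 3 => ℂ) 2 _).comp_hasDerivAt t h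
  refine hasDerivAt_pi.2 fun i => ?_
  fin_cases i
  · refine ((hU.pow (m + 1)).mul hre).congr_deriv ?_
    simp [coneVelocity]; ring
  · refine ((hU.pow m).mul him).congr_deriv ?_
    obtain ⟨n, rfl⟩ := Nat.exists_eq_succ_of_ne_zero hm.ne'
    simp [coneVelocity]; ring
  · refine ((hUc.pow (2 * m + 1)).mul (hh.const_mul I)).congr_deriv ?_
    simp [coneVelocity]; ring

lemma norm_sq_coneVelocity (m : ℕ) (w : ℂ) (U : Circle) (w' : ℂ) (θ : ℝ) :
    ‖coneVelocity m w U w' θ‖ ^ 2 = ‖w'‖ ^ 2 + coneHeightDeriv m w w' ^ 2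
      + θ ^ 2 * (((m + 1) * w.re) ^ 2 + (m * w.im) ^ 2 + ((2 * m + 1) * coneHeight m w) ^ 2) := by
  rw [EuclideanSpace.norm_sq_eq, Fin.sum_univ_three, norm_sq_eq_re_sq_add_im_sq w']
  simp only [coneVelocity, Matrix.cons_val, norm_mul, norm_pow, norm_conj, Circle.norm_coe, one_pow,
    one_mul, norm_I, Complex.sq_norm, normSq_add_mul_I]
  ring

lemma norm_le_norm_coneVelocity (m : ℕ) (w : ℂ) (U : Circle) (w' : ℂ) (θ : ℝ) :
    ‖w'‖ ≤ ‖coneVelocity m w U w' θ‖ := by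
  refine le_of_sq_le_sq ?_ (norm_nonneg _)
  rw [norm_sq_coneVelocity, add_assoc]
  exact le_add_of_nonneg_right (by positivity)

lemma mul_norm_coneMap_le_norm_coneVelocity (m : ℕ) (w : ℂ) (U : Circle) (w' : ℂ) (θ : ℝ) :
    m * |θ| * ‖coneMap m w U‖ ≤ ‖coneVelocity m w U w' θ‖ := by
  refine le_of_sq_le_sq ?_ (norm_nonneg _)
  have : (0 : ℝ) ≤ m := m.cast_nonneg
  rw [mul_pow, mul_pow, sq_abs, norm_sq_coneMap, norm_sq_coneVelocity,
    norm_sq_eq_re_sq_add_im_sq w]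
  calc (m : ℝ) ^ 2 * θ ^ 2 * (w.re ^ 2 + w.im ^ 2 + coneHeight m w ^ 2)
      = θ ^ 2 * ((m * w.re) ^ 2 + (m * w.im) ^ 2 + (m * coneHeight m w) ^ 2) := by ring
    _ ≤ θ ^ 2 * (((m + 1) * w.re) ^ 2 + (m * w.im) ^ 2 + ((2 * m + 1) * coneHeight m w) ^ 2) := by
      simp only [mul_pow _ w.re, mul_pow _ (coneHeight m w)]
      gcongr <;> linarith
    _ ≤ _ := le_add_of_nonneg_left (by positivity)

/-! ### Special Lagrangian charts -/

lemma IsLocalParam.of_invOn {M W : Set C3} {U : Set (EuclideanSpace ℝ (Fin 3))}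
    {φ : EuclideanSpace ℝ (Fin 3) → C3} {ψ : C3 → EuclideanSpace ℝ (Fin 3)}
    (hU : IsOpen U) (hW : IsOpen W) (hφ : ContDiffOn ℝ ∞ φ U)
    (himm : ∀ x ∈ U, Injective (fderiv ℝ φ x)) (hψ : ContinuousOn ψ W)
    (hφM : MapsTo φ U (M ∩ W)) (hψU : MapsTo ψ (M ∩ W) U) (hinv : InvOn ψ φ U (M ∩ W)) :
    IsLocalParam M U φ where
  isOpen_domain := hU
  smooth := hφ
  immersion := himm
  embedding := by
    have hleft : LeftInverse (hψU.restrict ψ (M ∩ W) U) (hφM.restrict φ U (M ∩ W)) :=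
      fun x => Subtype.ext (hinv.1 x.2)
    exact IsEmbedding.subtypeVal.comp (hleft.isEmbedding
      ((hψ.mono inter_subset_right).mapsToRestrict hψU) (hφ.continuousOn.mapsToRestrict hφM))
  open_image := ⟨W, hW, hφM.image_subset.antisymm fun z hz => ⟨ψ z, hψU hz, hinv.2 hz⟩⟩

/-- The first two real coordinates as a complex number. -/
def planeCoord : EuclideanSpace ℝ (Fin 3) →L[ℝ] ℂ :=
  equivRealProdCLM.symm.toContinuousLinearMap ∘L
    (EuclideanSpace.proj 0).prod (EuclideanSpace.proj 1)

/-- The chart of `torusCone m` centred at the orbit point with phase `U₀`: the first two coordinates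
are the real and imaginary part of `w` in `coneMap m w U`, and the third is the angle between `U`
and `U₀`. -/
def coneChart (m : ℕ) (U₀ : Circle) (y : EuclideanSpace ℝ (Fin 3)) : C3 :=
  coneMap m (planeCoord y) (U₀ * Circle.exp (y 2) : Circle)

/-- A domain of injectivity of `coneChart m U₀`. -/
def coneChartDomain : Set (EuclideanSpace ℝ (Fin 3)) := {y | planeCoord y ≠ 0 ∧ |y 2| < Real.pi}

/-- The inverse of `coneChart m U₀`, as a function on `ℂ³`. -/
def coneChartInv (m : ℕ) (U₀ : Circle) (z : C3) : EuclideanSpace ℝ (Fin 3) :=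
  !₂[(orbitBase m z).re, (orbitBase m z).im, arg (conj (U₀ : ℂ) * orbitPhase z)]

/-- An open set that meets the punctured cone `torusCone m` in the image of `coneChart m U₀`. -/
def coneChartTarget (U₀ : Circle) : Set C3 := {z | conj (U₀ : ℂ) * orbitPhase z ∈ slitPlane}

@[simp] lemma planeCoord_re (y : EuclideanSpace ℝ (Fin 3)) : (planeCoord y).re = y 0 := rfl

@[simp] lemma planeCoord_im (y : EuclideanSpace ℝ (Fin 3)) : (planeCoord y).im = y 1 := rfl

lemma isOpen_coneChartDomain : IsOpen coneChartDomain := by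
  have hangle : Continuous fun y : EuclideanSpace ℝ (Fin 3) => |y 2| := by fun_prop
  exact (isOpen_ne_fun planeCoord.continuous continuous_const).inter
    (isOpen_lt hangle continuous_const)

lemma isOpen_coneChartTarget (U₀ : Circle) : IsOpen (coneChartTarget U₀) :=
  isOpen_slitPlane.preimage (continuous_const.mul contDiff_orbitPhase.continuous)

lemma continuousOn_coneChartInv (m : ℕ) (U₀ : Circle) :
    ContinuousOn (coneChartInv m U₀) (coneChartTarget U₀) := by
  intro z hz
  have hb : ContinuousAt (orbitBase m) z :=
    (contDiffAt_orbitBase m (right_ne_zero_of_mul (slitPlane_ne_zero hz))).continuousAt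
  refine ContinuousAt.continuousWithinAt
    ((PiLp.continuous_toLp 2 _).continuousAt.comp (continuousAt_pi.2 fun i => ?_))
  fin_cases i
  · exact continuous_re.continuousAt.comp hb
  · exact continuous_im.continuousAt.comp hb
  · exact ContinuousAt.comp (f := fun z => conj (U₀ : ℂ) * orbitPhase z) (continuousAt_arg hz)
      (continuous_const.mul contDiff_orbitPhase.continuous).continuousAt

lemma contDiffAt_coneChart {m : ℕ} (hm : 0 < m) (U₀ : Circle) {y : EuclideanSpace ℝ (Fin 3)}
    (hy : planeCoord y ≠ 0) : ContDiffAt ℝ ∞ (coneChart m U₀) y := by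
  have hexp : ContDiff ℝ ∞ fun y : EuclideanSpace ℝ (Fin 3) =>
      ((U₀ * Circle.exp (y 2) : Circle) : ℂ) := by
    simp only [Circle.coe_mul, Circle.coe_exp]
    have hangle : ContDiff ℝ ∞ fun y : EuclideanSpace ℝ (Fin 3) => y 2 := contDiff_piLp_apply 2
    exact contDiff_const.mul ((contDiff_ofReal.comp hangle).mul contDiff_const).cexp
  have hpair : ContDiff ℝ ∞ fun y : EuclideanSpace ℝ (Fin 3) =>
      (planeCoord y, ((U₀ * Circle.exp (y 2) : Circle) : ℂ)) := planeCoord.contDiff.prodMk hexp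
  have hcone : ContDiffAt ℝ ∞ (fun p : ℂ × ℂ => coneMap m p.1 p.2)
      (planeCoord y, ((U₀ * Circle.exp (y 2) : Circle) : ℂ)) := contDiffAt_coneMap hm hy _
  exact ContDiffAt.comp (f := fun y : EuclideanSpace ℝ (Fin 3) =>
    (planeCoord y, ((U₀ * Circle.exp (y 2) : Circle) : ℂ))) y hcone hpair.contDiffAt

lemma fderiv_coneChart {m : ℕ} (hm : 0 < m) (U₀ : Circle) {y : EuclideanSpace ℝ (Fin 3)}
    (hy : planeCoord y ≠ 0) (v : EuclideanSpace ℝ (Fin 3)) :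
    fderiv ℝ (coneChart m U₀) y v =
      coneVelocity m (planeCoord y) (U₀ * Circle.exp (y 2) : Circle) (planeCoord v) (v 2) := by
  have hline : HasDerivAt (fun τ : ℝ => y + τ • v) v 0 := by
    simpa using ((hasDerivAt_id (0 : ℝ)).smul_const v).const_add y
  have hw : HasDerivAt (fun τ : ℝ => planeCoord (y + τ • v)) (planeCoord v) 0 :=
    planeCoord.hasFDerivAt.comp_hasDerivAt 0 hline
  have hangle : HasDerivAt (fun τ : ℝ => y 2 + τ * v 2) (v 2) 0 := by
    simpa using ((hasDerivAt_id (0 : ℝ)).mul_const (v 2)).const_add (y 2)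
  have hU : HasDerivAt (fun τ : ℝ => ((U₀ * Circle.exp (y 2 + τ * v 2) : Circle) : ℂ))
      ((U₀ * Circle.exp (y 2 + 0 * v 2) : Circle) * (v 2 * I)) 0 := by
    simp only [Circle.coe_mul, Circle.coe_exp, mul_assoc]
    exact (hangle.ofReal_comp.mul_const I).cexp.const_mul _
  rw [← ((contDiffAt_coneChart hm U₀ hy).differentiableAt (by simp)).lineDeriv_eq_fderiv, lineDeriv]
  have h := hasDerivAt_coneMap hm hw (by simpa using hy) hU
  simp only [zero_smul, add_zero, zero_mul] at h
  exact h.deriv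

lemma fderiv_coneChart_injective {m : ℕ} (hm : 0 < m) (U₀ : Circle)
    {y : EuclideanSpace ℝ (Fin 3)} (hy : planeCoord y ≠ 0) :
    Injective (fderiv ℝ (coneChart m U₀) y) := by
  rw [injective_iff_map_eq_zero]
  intro v hv
  set U := U₀ * Circle.exp (y 2)
  have hv' : ‖coneVelocity m (planeCoord y) U (planeCoord v) (v 2)‖ = 0 := by
    rw [← fderiv_coneChart hm U₀ hy, hv, norm_zero]
  have hplane : planeCoord v = 0 :=
    norm_le_zero_iff.1 (hv' ▸ norm_le_norm_coneVelocity m (planeCoord y) U _ _)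
  have hangle : v 2 = 0 := by
    have h := mul_norm_coneMap_le_norm_coneVelocity m (planeCoord y) U (planeCoord v) (v 2)
    rw [hv'] at h
    by_contra hv2
    have hpos : 0 < m * |v 2| * ‖coneMap m (planeCoord y) U‖ :=
      mul_pos (mul_pos (Nat.cast_pos.2 hm) (abs_pos.2 hv2))
        (norm_pos_iff.2 (coneMap_ne_zero m hy U))
    exact h.not_gt hpos
  ext i
  fin_cases i
  exacts [congrArg re hplane, congrArg im hplane, hangle]

lemma arg_conj_mul_orbitPhase_coneMap {m : ℕ} (hm : 0 < m) {w : ℂ} (hw : w ≠ 0) (U₀ U : Circle) :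
    arg (conj (U₀ : ℂ) * orbitPhase (coneMap m w U)) = arg (U₀⁻¹ * U : Circle) := by
  rw [orbitPhase_coneMap, real_smul, mul_left_comm, arg_real_mul _ (orbitPhase_factor_pos hm hw),
    ← Circle.coe_inv_eq_conj, ← Circle.coe_mul]

lemma planeCoord_coneChartInv_coneMap {m : ℕ} (hm : 0 < m) {w : ℂ} (hw : w ≠ 0) (U₀ U : Circle) :
    planeCoord (coneChartInv m U₀ (coneMap m w U)) = w := by
  conv_rhs => rw [← orbitBase_coneMap hm hw U]
  rfl

lemma coneMap_mem_coneChartTarget_iff {m : ℕ} (hm : 0 < m) {w : ℂ} (hw : w ≠ 0) (U₀ U : Circle) :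
    coneMap m w U ∈ coneChartTarget U₀ ↔ arg (U₀⁻¹ * U : Circle) ≠ Real.pi := by
  rw [coneChartTarget, mem_ofPred_eq, mem_slitPlane_iff_arg,
    arg_conj_mul_orbitPhase_coneMap hm hw]
  exact and_iff_left
    (mul_ne_zero ((map_ne_zero _).2 U₀.coe_ne_zero) (orbitPhase_coneMap_ne_zero hm hw U))

lemma mapsTo_coneChart {m : ℕ} (hm : 0 < m) (U₀ : Circle) :
    MapsTo (coneChart m U₀) coneChartDomain (torusCone m \ {0} ∩ coneChartTarget U₀) := by
  rintro y ⟨hy, hy2⟩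
  refine ⟨mem_torusCone_diff_zero.2 ⟨_, _, hy, rfl⟩, ?_⟩
  rw [coneChart, coneMap_mem_coneChartTarget_iff hm hy, inv_mul_cancel_left,
    Circle.arg_exp (abs_lt.1 hy2).1 (abs_lt.1 hy2).2.le]
  exact (abs_lt.1 hy2).2.ne

lemma mapsTo_coneChartInv {m : ℕ} (hm : 0 < m) (U₀ : Circle) :
    MapsTo (coneChartInv m U₀) (torusCone m \ {0} ∩ coneChartTarget U₀) coneChartDomain := by
  rintro z ⟨hz, hzW⟩
  obtain ⟨w, U, hw, rfl⟩ := mem_torusCone_diff_zero.1 hz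
  rw [coneMap_mem_coneChartTarget_iff hm hw] at hzW
  refine ⟨by rwa [planeCoord_coneChartInv_coneMap hm hw], ?_⟩
  change |arg _| < _
  rw [arg_conj_mul_orbitPhase_coneMap hm hw, abs_lt]
  exact ⟨neg_pi_lt_arg _, (arg_le_pi _).lt_of_ne hzW⟩

lemma invOn_coneChartInv {m : ℕ} (hm : 0 < m) (U₀ : Circle) :
    InvOn (coneChartInv m U₀) (coneChart m U₀) coneChartDomain
      (torusCone m \ {0} ∩ coneChartTarget U₀) := by
  constructor
  · rintro y ⟨hy, hy2⟩
    have hplane := planeCoord_coneChartInv_coneMap hm hy U₀ (U₀ * Circle.exp (y 2))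
    ext i
    fin_cases i
    · exact congrArg re hplane
    · exact congrArg im hplane
    · change arg (_ * orbitPhase (coneMap _ _ _)) = _
      rw [arg_conj_mul_orbitPhase_coneMap hm hy, inv_mul_cancel_left,
        Circle.arg_exp (abs_lt.1 hy2).1 (abs_lt.1 hy2).2.le]
      rfl
  · rintro z ⟨hz, -⟩
    obtain ⟨w, U, hw, rfl⟩ := mem_torusCone_diff_zero.1 hz
    rw [coneChart, planeCoord_coneChartInv_coneMap hm hw]
    change coneMap m w (U₀ * Circle.exp (arg _) : Circle) = _
    rw [arg_conj_mul_orbitPhase_coneMap hm hw, Circle.exp_arg, mul_inv_cancel_left]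

lemma isLocalParam_coneChart {m : ℕ} (hm : 0 < m) (U₀ : Circle) :
    IsLocalParam (torusCone m \ {0}) coneChartDomain (coneChart m U₀) :=
  .of_invOn isOpen_coneChartDomain (isOpen_coneChartTarget U₀)
    (fun _ hy => (contDiffAt_coneChart hm U₀ hy.1).contDiffWithinAt)
    (fun _ hy => fderiv_coneChart_injective hm U₀ hy.1) (continuousOn_coneChartInv m U₀)
    (mapsTo_coneChart hm U₀) (mapsTo_coneChartInv hm U₀) (invOn_coneChartInv hm U₀)

lemma reOmega_eq_vol3 {v : Fin 3 → C3} {V : Matrix (Fin 3) (Fin 3) ℂ}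
    (hV : V = Matrix.of fun i j => v j i) {G : Matrix (Fin 3) (Fin 3) ℝ}
    (hG : V.conjTranspose * V = G.map ofRealHom) {r : ℝ} (hr : 0 ≤ r) (hdet : V.det = r) :
    reOmega v = vol3 v := by
  have hGram : (Matrix.of fun i j => (inner ℂ (v i) (v j)).re) = G := by
    ext i j
    have hij := congrArg re (congrFun (congrFun hG i) j)
    rw [Matrix.map_apply, ofRealHom_eq_coe, ofReal_re] at hij
    rw [← hij, hV, Matrix.mul_apply, Matrix.of_apply, PiLp.inner_apply]
    simp [mul_comm]
  have hdetG : ofRealHom G.det = (r : ℂ) ^ 2 := by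
    rw [RingHom.map_det, RingHom.mapMatrix_apply, ← hG, Matrix.det_mul, Matrix.det_conjTranspose,
      hdet]
    simp [sq]
  have hdetG' : G.det = r ^ 2 := by
    rw [ofRealHom_eq_coe] at hdetG
    exact_mod_cast hdetG
  rw [reOmega, vol3, hGram, hdetG', Real.sqrt_sq hr, ← hV, hdet, ofReal_re]

/-- The matrix whose columns are the coordinate vectors of `coneChart m U₀`, up to the action of the
circle: in terms of the height `h`, `a = ∂h/∂x`, `b = ∂h/∂y` and `c = (2m + 1) h`. -/
def coneFrame (a b c : ℝ) : Matrix (Fin 3) (Fin 3) ℂ :=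
  !![1, 0, a * c * I; 0, 1, b * c * I; a * I, b * I, c]

lemma conjTranspose_mul_coneFrame (a b c : ℝ) :
    (coneFrame a b c).conjTranspose * coneFrame a b c =
      (!![1 + a ^ 2, a * b, 0; a * b, 1 + b ^ 2, 0; 0, 0, c ^ 2 * (1 + a ^ 2 + b ^ 2)] :
        Matrix (Fin 3) (Fin 3) ℝ).map ofRealHom := by
  ext i j
  fin_cases i <;> fin_cases j <;>
    simp [coneFrame, Matrix.mul_apply, Fin.sum_univ_three] <;> ring_nf <;> simp [I_sq]

lemma det_coneFrame (a b c : ℝ) : (coneFrame a b c).det = (c * (1 + a ^ 2 + b ^ 2) : ℝ) := by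
  rw [Matrix.det_fin_three]
  simp only [coneFrame, Matrix.of_apply, Matrix.cons_val]
  push_cast
  linear_combination (-(a ^ 2 * c) - b ^ 2 * c : ℂ) * I_sq

lemma coordVec_coneChart {m : ℕ} (hm : 0 < m) (U₀ : Circle) {y : EuclideanSpace ℝ (Fin 3)}
    (hy : planeCoord y ≠ 0) :
    (Matrix.of fun i j => coordVec (coneChart m U₀) y j i) =
      weightMatrix m (U₀ * Circle.exp (y 2) : Circle) *
        coneFrame (coneHeightDeriv m (planeCoord y) 1) (coneHeightDeriv m (planeCoord y) I)
          ((2 * m + 1) * coneHeight m (planeCoord y)) := by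
  have hh : (coneHeight m (planeCoord y) : ℂ) ≠ 0 := by exact_mod_cast (coneHeight_pos hm hy).ne'
  have hm' : (2 * m + 1 : ℂ) ≠ 0 := by exact_mod_cast (2 * m).succ_ne_zero
  have hcoord (j : Fin 3) : coordVec (coneChart m U₀) y j =
      coneVelocity m (planeCoord y) (U₀ * Circle.exp (y 2) : Circle)
        (planeCoord (EuclideanSpace.single j 1)) (EuclideanSpace.single j (1 : ℝ) 2) :=
    fderiv_coneChart hm U₀ hy _
  ext i j
  rw [Matrix.of_apply, hcoord, weightMatrix, Matrix.diagonal_mul]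
  generalize U₀ * Circle.exp (y 2) = U
  have hcancel (c : ℂ) : c / ((2 * m + 1) * coneHeight m (planeCoord y)) *
      ((2 * m + 1) * coneHeight m (planeCoord y)) = c := div_mul_cancel₀ _ (mul_ne_zero hm' hh)
  fin_cases i <;> fin_cases j <;>
    simp [coneVelocity, coneFrame, coneHeightDeriv, hcancel]
  · ring
  · ring
  · linear_combination
      (-(2 * m + 1) * coneHeight m (planeCoord y) * conj (U : ℂ) ^ (2 * m + 1) : ℂ) * I_sq

lemma reOmega_coordVec_coneChart {m : ℕ} (hm : 0 < m) (U₀ : Circle)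
    {y : EuclideanSpace ℝ (Fin 3)} (hy : planeCoord y ≠ 0) :
    reOmega (coordVec (coneChart m U₀) y) = vol3 (coordVec (coneChart m U₀) y) := by
  have hV := (coordVec_coneChart hm U₀ hy).symm
  have hh := coneHeight_pos hm hy
  refine reOmega_eq_vol3 hV
    ((conjTranspose_mul_weightMatrix_mul m _ _).trans (conjTranspose_mul_coneFrame _ _ _)) ?_
    (by rw [Matrix.det_mul, det_weightMatrix, one_mul, det_coneFrame])
  positivity

lemma isSpecialLagrangian_torusCone {m : ℕ} (hm : 0 < m) :
    IsSpecialLagrangian (torusCone m \ {0}) := by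
  intro p hp
  obtain ⟨w, U, hw, rfl⟩ := mem_torusCone_diff_zero.1 hp
  have hplane : planeCoord !₂[w.re, w.im, 0] = w := rfl
  refine ⟨coneChartDomain, coneChart m U, isLocalParam_coneChart hm U,
    ⟨!₂[w.re, w.im, 0], ⟨hplane.symm ▸ hw, ?_⟩, ?_⟩,
    fun y hy => reOmega_coordVec_coneChart hm U hy.1⟩
  · simpa using Real.pi_pos
  · simp [coneChart, hplane]

/-! ### The link -/

lemma isSpecialLagrangianCone_of_smul_mem {C : Set C3} (hC : IsSpecialLagrangian (C \ {0}))
    (hlink : (link C).Nonempty) (hsmul : ∀ z ∈ C, ∀ r : ℝ, 0 ≤ r → r • z ∈ C) :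
    IsSpecialLagrangianCone C := by
  refine ⟨Subset.antisymm (fun z hz => ?_) ?_, hC⟩
  · rcases eq_or_ne z 0 with rfl | h0
    · obtain ⟨x, hx⟩ := hlink
      exact ⟨0, le_rfl, x, hx, (zero_smul ℝ x).symm⟩
    · exact ⟨‖z‖, norm_nonneg z, NormedSpace.normalize z,
        ⟨hsmul z hz _ (inv_nonneg.2 (norm_nonneg z)),
          mem_sphere_zero_iff_norm.2 (NormedSpace.norm_normalize h0)⟩,
        (NormedSpace.norm_smul_normalize z).symm⟩
  · rintro _ ⟨r, hr, x, hx, rfl⟩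
    exact hsmul x hx.1 r hr

lemma contMDiff_circle_coe : ContMDiff (𝓡 1) 𝓘(ℝ, ℂ) ∞ (fun x : Circle => (x : ℂ)) :=
  haveI := finrank_real_complex_fact'
  contMDiff_coe_sphere (E := ℂ) (n := 1)

lemma mfderiv_circle_coe_injective (x : Circle) :
    Injective (mfderiv (𝓡 1) 𝓘(ℝ, ℂ) (fun x : Circle => (x : ℂ)) x) :=
  haveI := finrank_real_complex_fact'
  injective_mvfderiv_subtypeVal_sphere (E := ℂ) (n := 1) x

lemma contMDiff_torus_coe :
    ContMDiff ((𝓡 1).prod (𝓡 1)) 𝓘(ℝ, ℂ × ℂ) ∞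
      (fun x : Circle × Circle => ((x.1, x.2) : ℂ × ℂ)) :=
  (contMDiff_circle_coe.comp contMDiff_fst).prodMk_space (contMDiff_circle_coe.comp contMDiff_snd)

lemma mfderiv_torus_coe_injective (x : Circle × Circle) :
    Injective (mfderiv ((𝓡 1).prod (𝓡 1)) 𝓘(ℝ, ℂ × ℂ)
      (fun x : Circle × Circle => ((x.1, x.2) : ℂ × ℂ)) x) := by
  have h (y : Circle) : MDifferentiableAt (𝓡 1) 𝓘(ℝ, ℂ) (fun x : Circle => (x : ℂ)) y :=
    contMDiff_circle_coe.mdifferentiableAt (by simp)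
  rw [modelWithCornersSelf_prod, ← chartedSpaceSelf_prod]
  change Injective (mfderiv ((𝓡 1).prod (𝓡 1)) (𝓘(ℝ, ℂ).prod 𝓘(ℝ, ℂ))
    (Prod.map (fun x : Circle => (x : ℂ)) (fun x : Circle => (x : ℂ))) x)
  rw [mfderiv_prodMap (h x.1) (h x.2)]
  exact (mfderiv_circle_coe_injective x.1).prodMap (mfderiv_circle_coe_injective x.2)

lemma isEmbeddedTorus_range {Φ : ℂ × ℂ → C3} {Ψ : C3 → ℂ × ℂ}
    (hΦ : ∀ x : Circle × Circle, ContDiffAt ℝ ∞ Φ (x.1, x.2))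
    (hΨ : ∀ x : Circle × Circle, ContDiffAt ℝ ∞ Ψ (Φ (x.1, x.2)))
    (hΨΦ : ∀ x : Circle × Circle, Ψ (Φ (x.1, x.2)) = (↑x.1, ↑x.2)) :
    IsEmbeddedTorus (range fun x : Circle × Circle => Φ (x.1, x.2)) := by
  set F : Circle × Circle → C3 := fun x => Φ (x.1, x.2)
  have hF : ContMDiff ((𝓡 1).prod (𝓡 1)) 𝓘(ℝ, C3) ∞ F := fun x =>
    ContMDiffAt.comp (g := Φ) x (hΦ x).contMDiffAt (contMDiff_torus_coe x)
  have hinv : Ψ ∘ F = fun x => ((x.1, x.2) : ℂ × ℂ) := funext hΨΦ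
  refine ⟨F, hF, fun x => ?_, (hF.continuous.isClosedEmbedding fun x y hxy => ?_).isEmbedding, rfl⟩
  · have hinj := mfderiv_torus_coe_injective x
    rw [← hinv, mfderiv_comp x ((hΨ x).contMDiffAt.mdifferentiableAt (by simp))
      (hF.mdifferentiableAt (by simp))] at hinj
    exact Injective.of_comp hinj
  · have h := congrArg Ψ hxy
    rw [hΨΦ, hΨΦ, Prod.ext_iff] at h
    exact Prod.ext (Circle.ext h.1) (Circle.ext h.2)

/-- The radial projection of `coneMap m` to the sphere, which maps `S¹ × S¹` onto the link of
`torusCone m`. -/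
def linkMap (m : ℕ) (p : ℂ × ℂ) : C3 := NormedSpace.normalize (coneMap m p.1 p.2)

/-- A left inverse of `linkMap m` on `S¹ × S¹`, as a function on `ℂ³`. -/
def linkInv (m : ℕ) (z : C3) : ℂ × ℂ := (NormedSpace.normalize (orbitBase m z), orbitAngle z)

lemma linkMap_mem_link (m : ℕ) (x : Circle × Circle) :
    linkMap m (x.1, x.2) ∈ link (torusCone m) :=
  ⟨smul_mem_torusCone ⟨x.1, x.2, rfl⟩ (inv_nonneg.2 (norm_nonneg _)),
    mem_sphere_zero_iff_norm.2
      (NormedSpace.norm_normalize (coneMap_ne_zero m x.1.coe_ne_zero x.2))⟩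

lemma linkMap_normalize (m : ℕ) {w : ℂ} (hw : w ≠ 0) {U : Circle} (h : ‖coneMap m w U‖ = 1) :
    linkMap m (NormedSpace.normalize w, U) = coneMap m w U := by
  have hV : coneMap m (NormedSpace.normalize w) U = ‖w‖⁻¹ • coneMap m w U :=
    coneMap_smul m (inv_nonneg.2 (norm_nonneg w)) w U
  change NormedSpace.normalize (coneMap m (NormedSpace.normalize w) U) = _
  rw [hV, NormedSpace.normalize_smul_of_pos (inv_pos.2 (norm_pos_iff.2 hw)),
    NormedSpace.normalize_eq_self_of_norm_eq_one h]

lemma range_linkMap (m : ℕ) :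
    range (fun x : Circle × Circle => linkMap m (x.1, x.2)) = link (torusCone m) := by
  refine (range_subset_iff.2 (linkMap_mem_link m)).antisymm ?_
  rintro _ ⟨⟨w, U, rfl⟩, h1⟩
  have hw : w ≠ 0 := by
    rintro rfl
    simp [coneMap_zero] at h1
  exact ⟨(⟨_, mem_sphere_zero_iff_norm.2 (NormedSpace.norm_normalize hw)⟩, U),
    linkMap_normalize m hw (mem_sphere_zero_iff_norm.1 h1)⟩

lemma exists_pos_linkMap_eq (m : ℕ) (x : Circle × Circle) :
    ∃ r : ℝ, 0 < r ∧ linkMap m (x.1, x.2) = coneMap m (r • x.1) x.2 := by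
  have hr := inv_pos.2 (norm_pos_iff.2 (coneMap_ne_zero m x.1.coe_ne_zero x.2))
  exact ⟨_, hr, (coneMap_smul m hr.le x.1 x.2).symm⟩

section Pos

variable {m : ℕ} (hm : 0 < m) (x : Circle × Circle)

include hm

lemma linkInv_linkMap : linkInv m (linkMap m (x.1, x.2)) = (↑x.1, ↑x.2) := by
  obtain ⟨r, hr, hx⟩ := exists_pos_linkMap_eq m x
  have hr0 := smul_ne_zero hr.ne' x.1.coe_ne_zero
  rw [linkInv, hx, orbitBase_coneMap hm hr0, orbitAngle_coneMap hm hr0,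
    NormedSpace.normalize_smul_of_pos hr,
    NormedSpace.normalize_eq_self_of_norm_eq_one x.1.norm_coe]

lemma contDiffAt_linkMap : ContDiffAt ℝ ∞ (linkMap m) (x.1, x.2) :=
  ContDiffAt.comp (f := fun p : ℂ × ℂ => coneMap m p.1 p.2) (↑x.1, ↑x.2)
    (contDiffAt_normalize (coneMap_ne_zero m x.1.coe_ne_zero x.2))
    (contDiffAt_coneMap hm x.1.coe_ne_zero x.2)

lemma contDiffAt_linkInv : ContDiffAt ℝ ∞ (linkInv m) (linkMap m (x.1, x.2)) := by
  obtain ⟨r, hr, hx⟩ := exists_pos_linkMap_eq m x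
  have hr0 := smul_ne_zero hr.ne' x.1.coe_ne_zero
  have hphase := orbitPhase_coneMap_ne_zero hm hr0 x.2
  have hbase : orbitBase m (coneMap m (r • x.1) x.2) ≠ 0 := by rwa [orbitBase_coneMap hm hr0]
  rw [hx]
  exact ((contDiffAt_normalize hbase).comp _ (contDiffAt_orbitBase m hphase)).prodMk
    (contDiffAt_orbitAngle hphase)

lemma isEmbeddedTorus_link_torusCone : IsEmbeddedTorus (link (torusCone m)) := by
  rw [← range_linkMap]
  exact isEmbeddedTorus_range (contDiffAt_linkMap hm) (contDiffAt_linkInv hm) (linkInv_linkMap hm)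

lemma isSpecialLagrangianCone_torusCone : IsSpecialLagrangianCone (torusCone m) :=
  isSpecialLagrangianCone_of_smul_mem (isSpecialLagrangian_torusCone hm)
    ⟨_, linkMap_mem_link m 1⟩ fun _ hz _ hr => smul_mem_torusCone hz hr

lemma exists_mem_link_torusCone_orbitAngle_eq (U : Circle) :
    ∃ p ∈ link (torusCone m), orbitAngle p = U :=
  ⟨_, linkMap_mem_link m (1, U), congrArg Prod.snd (linkInv_linkMap hm (1, U))⟩

end Pos

/-! ### Slow rotation and non-isometry -/

lemma exists_eq_mul_I_of_eventually_norm_eq_one {U : ℝ → ℂ} {U' : ℂ} {t : ℝ}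
    (hU : HasDerivAt U U' t) (h1 : ∀ᶠ s in 𝓝 t, ‖U s‖ = 1) : ∃ θ : ℝ, U' = U t * (θ * I) := by
  have hsq : HasDerivAt (fun s => ‖U s‖ ^ 2) 0 t :=
    (hasDerivAt_const t (1 : ℝ)).congr_of_eventuallyEq <|
      h1.mono fun s hs => by simp only [hs, one_pow]
  have hre : (U' * conj (U t)).re = 0 := by
    simpa [Complex.inner] using hU.norm_sq.unique hsq
  have him : U' * conj (U t) = (U' * conj (U t)).im * I := by
    conv_lhs => rw [← re_add_im (U' * conj (U t)), hre, ofReal_zero, zero_add]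
  have hUU : conj (U t) * U t = 1 := by
    rw [conj_mul', h1.self_of_nhds, ofReal_one, one_pow]
  refine ⟨(U' * conj (U t)).im, ?_⟩
  rw [← him, mul_left_comm, mul_comm (U t), hUU, mul_one]

lemma exists_hasDerivAt_orbitAngle_comp {m : ℕ} (hm : 0 < m) {z : ℝ → C3} {z' : C3} {t : ℝ}
    (hmem : ∀ᶠ s in 𝓝 t, z s ∈ torusCone m \ {0}) (hz : HasDerivAt z z' t) :
    ∃ U', HasDerivAt (orbitAngle ∘ z) U' t ∧ m * ‖z t‖ * ‖U'‖ ≤ ‖z'‖ := by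
  obtain ⟨w₀, U₀, hw₀, hzt⟩ := mem_torusCone_diff_zero.1 hmem.self_of_nhds
  have hphase : orbitPhase (z t) ≠ 0 := hzt ▸ orbitPhase_coneMap_ne_zero hm hw₀ U₀
  have hwt : orbitBase m (z t) = w₀ := hzt ▸ orbitBase_coneMap hm hw₀ U₀
  have hUt : orbitAngle (z t) = U₀ := hzt ▸ orbitAngle_coneMap hm hw₀ U₀
  have hw : HasDerivAt (fun s => orbitBase m (z s)) (fderiv ℝ (orbitBase m) (z t) z') t :=
    ((contDiffAt_orbitBase m hphase).differentiableAt (by simp)).hasFDerivAt.comp_hasDerivAt t hz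
  have hU : HasDerivAt (fun s => orbitAngle (z s)) (fderiv ℝ orbitAngle (z t) z') t :=
    ((contDiffAt_orbitAngle hphase).differentiableAt (by simp)).hasFDerivAt.comp_hasDerivAt t hz
  have hcoord : ∀ᶠ s in 𝓝 t, ‖orbitAngle (z s)‖ = 1 ∧
      z s = coneMap m (orbitBase m (z s)) (orbitAngle (z s)) := hmem.mono fun s hs => by
    obtain ⟨w, U, hw, hs⟩ := mem_torusCone_diff_zero.1 hs
    rw [hs, orbitAngle_coneMap hm hw, orbitBase_coneMap hm hw]
    exact ⟨U.norm_coe, rfl⟩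
  obtain ⟨θ, hθ⟩ := exists_eq_mul_I_of_eventually_norm_eq_one hU (hcoord.mono fun _ => And.left)
  refine ⟨_, hU, ?_⟩
  rw [hθ] at hU ⊢
  have hz' := hz.unique <| (hasDerivAt_coneMap hm hw (by rwa [hwt]) hU).congr_of_eventuallyEq
    (hcoord.mono fun _ => And.right)
  rw [hwt, hUt] at hz'
  calc m * ‖z t‖ * ‖orbitAngle (z t) * (θ * I)‖
    _ = m * |θ| * ‖coneMap m w₀ U₀‖ := by
      rw [hUt, norm_mul, Circle.norm_coe, norm_mul, norm_I, norm_real, Real.norm_eq_abs, hzt]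
      ring
    _ ≤ ‖z'‖ := hz' ▸ mul_norm_coneMap_le_norm_coneVelocity m w₀ U₀ _ θ

lemma link_subset_diff_zero (C : Set C3) : link C ⊆ C \ {0} := fun _ hp =>
  ⟨hp.1, ne_zero_of_mem_unit_sphere ⟨_, hp.2⟩⟩

lemma IsMetricPreserving.mul_norm_orbitAngle_sub_le {M : Set C3} {f : C3 → C3} {k : ℕ} (hk : 0 < k)
    (hf : IsMetricPreserving f M (torusCone k \ {0})) (hM : IsEmbeddedThreefold M)
    {γ γ' : ℝ → C3} (hγM : ∀ t, γ t ∈ M) (hγ : ∀ t, HasDerivAt γ (γ' t) t)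
    (hfγ : ∀ t, ‖f (γ t)‖ = 1) {L : ℝ} (hL : ∀ t ∈ Icc (0 : ℝ) 1, ‖γ' t‖ ≤ L) :
    k * ‖orbitAngle (f (γ 1)) - orbitAngle (f (γ 0))‖ ≤ L := by
  have hk' : (0 : ℝ) < k := Nat.cast_pos.2 hk
  have hspeed (t : ℝ) : ∃ U', HasDerivAt (orbitAngle ∘ f ∘ γ) U' t ∧ k * ‖U'‖ ≤ ‖γ' t‖ := by
    obtain ⟨v, hv, hvnorm⟩ := hf.exists_hasDerivAt_comp hM (.of_forall hγM) (hγ t)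
    simpa only [comp_def, hfγ, mul_one, hvnorm] using
      exists_hasDerivAt_orbitAngle_comp hk (.of_forall fun s => hf.1 (hγM s)) hv
  choose U' hU' hle using hspeed
  rw [← le_div_iff₀' hk']
  exact norm_image_sub_le_of_norm_deriv_le_segment_01' (f := orbitAngle ∘ f ∘ γ)
    (fun t _ => (hU' t).hasDerivWithinAt)
    fun t ht => (le_div_iff₀' hk').2 ((hle t).trans (hL t (Ico_subset_Icc_self ht)))

lemma IsSpecialLagrangianCone.eventually_not_areIsometric_torusCone {C : Set C3}
    (hC : IsSpecialLagrangianCone C) (htorus : IsEmbeddedTorus (link C)) :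
    ∀ᶠ k in atTop, ¬ AreIsometric (C \ {0}) (torusCone k \ {0}) := by
  obtain ⟨L, hL⟩ := htorus.exists_forall_exists_curve
  filter_upwards [eventually_gt_atTop 0,
    (tendsto_natCast_atTop_atTop (R := ℝ)).eventually_gt_atTop L] with k hk hkL ⟨f, g, hf, hg, hinv⟩
  have hD := isSpecialLagrangianCone_torusCone hk
  have hlink := htorus.isCompact
  have hlink' := (isEmbeddedTorus_link_torusCone hk).isCompact
  have hpreimage (U : Circle) : ∃ p ∈ link C, orbitAngle (f p) = U := by
    obtain ⟨q, hq, hqU⟩ := exists_mem_link_torusCone_orbitAngle_eq hk U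
    have hq0 := link_subset_diff_zero _ hq
    refine ⟨g q, ⟨(hg.1 hq0).1, mem_sphere_zero_iff_norm.2 ?_⟩, by rw [hinv.2 hq0, hqU]⟩
    rw [hD.norm_map_eq hC hlink' hlink hg hf hinv.symm hq0, mem_sphere_zero_iff_norm.1 hq.2]
  obtain ⟨p, hp, hpU⟩ := hpreimage 1
  obtain ⟨q, hq, hqU⟩ := hpreimage (-1)
  obtain ⟨γ, γ', rfl, rfl, hγC, hγ, hγL⟩ := hL p hp q hq
  have hγM (t : ℝ) : γ t ∈ C \ {0} := link_subset_diff_zero C (hγC t)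
  have hfγ (t : ℝ) : ‖f (γ t)‖ = 1 := by
    rw [hC.norm_map_eq hD hlink hlink' hf hg hinv (hγM t), mem_sphere_zero_iff_norm.1 (hγC t).2]
  have hle := hf.mul_norm_orbitAngle_sub_le hk hC.2.isEmbeddedThreefold hγM hγ hfγ hγL
  have htwo : ‖((-1 : Circle) : ℂ) - (1 : Circle)‖ = 2 := by
    rw [Circle.coe_neg, Circle.coe_one, ← neg_add', norm_neg]
    norm_num
  rw [hpU, hqU, htwo] at hle
  linarith

end

theorem theorem3 :
    ∃ C : ℕ → Set C3,
      (∀ k, IsSpecialLagrangianCone (C k) ∧ IsEmbeddedTorus (link (C k)) ∧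
        IsCircleInvariant (link (C k))) ∧
      Pairwise fun j k => ¬ AreIsometric (C j \ {0}) (C k \ {0}) := by
  let r (C C' : Set C3) : Prop := ¬ AreIsometric (C \ {0}) (C' \ {0})
  have : Std.Symm r := ⟨fun _ _ => mt AreIsometric.symm⟩
  refine exists_seq_of_forall_finset_exists' (fun C => IsSpecialLagrangianCone C ∧
    IsEmbeddedTorus (link C) ∧ IsCircleInvariant (link C)) r fun s hs => ?_
  have hne : ∀ᶠ k in atTop, ∀ C ∈ s, ¬ AreIsometric (C \ {0}) (torusCone k \ {0}) :=
    (eventually_all_finset s).2 fun C hC =>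
      (hs C hC).1.eventually_not_areIsometric_torusCone (hs C hC).2.1
  obtain ⟨k, hk, hks⟩ := ((eventually_gt_atTop 0).and hne).exists
  exact ⟨torusCone k, ⟨isSpecialLagrangianCone_torusCone hk, isEmbeddedTorus_link_torusCone hk,
    isCircleInvariant_link_torusCone k⟩, hks⟩
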